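/- Let $T=[-1,1]\times\{0\}\,\cup\,\{0\}\times[0,1]\subset\mathbb R^2$. For a space $X$ and $n\ge 0$, let $C_n(X)$ denote the configuration space of $n$ distinct unlabelled points of $X$, i.e. the space of injective maps $\{1,\dots,n\}\to X$ (a subspace of $X^n$) modulo the action of the symmetric group $S_n$, with the quotient topology; write $C_n=C_n(\mathbb R^2)$. Then for every $n\ge 0$: 1. Every loop in $C_n$ is freely homotopic (through loops in $C_n$) to a loop in $C_n$ that only passes through configurations all of whose points lie in $T$. 2. For every base point $c\in C_n(T)$, the homomorphism $\pi_1(C_n(T),c)\to\pi_1(C_n,c)$ induced by the inclusion $T\subset\mathbb R^2$ is surjective. 3. Every braid can be placed in the three-page book $T\times[0,1]$. Precisely, by a geometric braid on $n$ strands we mean an $n$-tuple of continuous maps $s_1,\dots,s_n:[0,1]\to\mathbb R^2$ such that $s_1(t),\dots,s_n(t)$ are pairwise distinct for every $t$ and $\{s_1(1),\dots,s_n(1)\}=\{s_1(0),\dots,s_n(0)\}$; it represents the subset $\{(s_i(t),t)\}$ of $\mathbb R^2\times[0,1]$. Every geometric braid with $s_i(0)\in T$ for all $i$ can be continuously deformed,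 through geometric braids with the same initial and final points $s_i(0)$, $s_i(1)$, to a geometric braid contained in $T\times[0,1]$. -/

import Mathlib

open Set
open scoped unitInterval

/-- The ordered configuration space: `n`-tuples of pairwise distinct points of `X`, with the
topology induced from the product `Fin n → X`. -/
abbrev OrdConf (n : ℕ) (X : Type*) : Type _ :=
  {f : Fin n → X // Function.Injective f}

/-- The symmetric group acts on ordered configurations by relabelling the points. -/
instance OrdConf.instMulAction (n : ℕ) (X : Type*) :
    MulAction (Equiv.Perm (Fin n)) (OrdConf n X) where
  smul e f := ⟨fun i => f.1 (e⁻¹ i), f.2.comp (e⁻¹).injective⟩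
  one_smul _ := rfl
  mul_smul e e' f := by
    apply Subtype.ext
    funext i
    show f.1 ((e * e')⁻¹ i) = f.1 (e'⁻¹ (e⁻¹ i))
    rw [mul_inv_rev, Equiv.Perm.mul_apply]

theorem OrdConf.smul_apply {n : ℕ} {X : Type*} (e : Equiv.Perm (Fin n)) (f : OrdConf n X)
    (i : Fin n) : (e • f).1 i = f.1 (e⁻¹ i) := rfl

/-- The configuration space of `n` (indistinguishable) distinct points of `X`: the quotient of the
ordered configuration space by the symmetric group, with the quotient topology. -/
abbrev Conf (n : ℕ) (X : Type*) : Type _ :=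
  MulAction.orbitRel.Quotient (Equiv.Perm (Fin n)) (OrdConf n X)

/-- The set of the `n` points that make up a configuration. -/
def Conf.points {n : ℕ} {X : Type*} (c : Conf n X) : Set X :=
  Quotient.liftOn' c (fun f => range f.1) (by
    rintro f g ⟨e, rfl⟩
    exact (e⁻¹ : Equiv.Perm (Fin n)).surjective.range_comp g.1)

theorem Conf.points_mk {n : ℕ} {X : Type*} (f : OrdConf n X) :
    Conf.points (Quotient.mk'' f : Conf n X) = range f.1 := rfl

/-- The inclusion `Conf n S → Conf n X` of configuration spaces, for a subspace `S` of `X`. -/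
def Conf.incl (n : ℕ) {X : Type*} [TopologicalSpace X] (S : Set X) :
    C(Conf n S, Conf n X) where
  toFun := Quotient.map'
    (fun f => (⟨fun i => (f.1 i : X), Subtype.val_injective.comp f.2⟩ : OrdConf n X)) (by
      rintro f g ⟨e, rfl⟩
      exact ⟨e, rfl⟩)
  continuous_toFun := by
    refine Continuous.quotient_map' ?_ _
    exact Continuous.subtype_mk (continuous_pi fun i =>
      continuous_subtype_val.comp ((continuous_apply i).comp continuous_subtype_val)) _

theorem Conf.points_incl {n : ℕ} {X : Type*} [TopologicalSpace X] {S : Set X}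
    (c : Conf n S) : (Conf.incl n S c).points = Subtype.val '' c.points := by
  induction c using Quotient.inductionOn' with
  | h f => exact range_comp Subtype.val f.1

/-- The plane (only its topology matters). -/
abbrev Plane : Type := ℝ × ℝ

/-- The T-shaped set `[-1, 1] × {0} ∪ {0} × [0, 1]`. -/
def tShape : Set Plane :=
  Icc (-1 : ℝ) 1 ×ˢ {(0 : ℝ)} ∪ {(0 : ℝ)} ×ˢ Icc (0 : ℝ) 1

/-- A geometric braid on `n` strands: strand `i` is the graph `{(strand i t, t)}` in `Plane × I`,
distinct strands are disjoint, and the set of initial points is the set of final points. -/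
@[ext]
structure GeomBraid (n : ℕ) where
  strand : Fin n → C(I, Plane)
  disjoint : ∀ t : I, Function.Injective fun i => strand i t
  closed : (range fun i => strand i 1) = range fun i => strand i 0

/-- The subset of `Plane × I` swept out by the strands of a braid. -/
def GeomBraid.carrier {n : ℕ} (β : GeomBraid n) : Set (Plane × I) :=
  {p | ∃ i, β.strand i p.2 = p.1}

/-- Isotopy of geometric braids: a deformation through geometric braids, all with the same
endpoints. -/
def GeomBraid.Isotopic {n : ℕ} (β β' : GeomBraid n) : Prop :=
  ∃ H : I → GeomBraid n,
    (∀ i, Continuous fun p : I × I => (H p.1).strand i p.2) ∧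
    H 0 = β ∧ H 1 = β' ∧
    ∀ u i, (H u).strand i 0 = β.strand i 0 ∧ (H u).strand i 1 = β.strand i 1

/-- The three-page book: the T-shaped set times the interval, that is three rectangles (pages)
glued along the common edge (binding) `{(0, 0)} × I`. -/
def threePageBook : Set (Plane × I) := tShape ×ˢ univ

variable {n : ℕ}

/-! ### Paths of configurations inside convex and star-shaped sets -/

/-! All three claims reduce to `exists_homotopic_tShape` about ordered configurations: a path with
both ends in the T can be pushed into the T relative to its endpoints. Loops of unordered
configurations lift to such paths through the covering by ordered ones, and a geometric braid
already is such a path.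

The ordered configuration space is cut into convex cells by the lexicographic order of the points.
Each cell has a base configuration on the horizontal bar, so any path class can be transported to a
class between base configurations (`toBaseClass`). The transported classes with a representative in
the T are closed under composition and inversion, so it suffices to treat short pieces of a path
(`isTRep_toBaseClass_mk`).

A short piece stays in a convex set where all strict coordinate inequalities of one configuration
persist (`gridCell`). There it may be replaced by any other path with the same ends, in particular
by a bubble sort exchanging lexicographic neighbours one pair at a time
(`isTRep_toBaseClass_of_mem_gridCell`). During an exchange one point passes above the other. The
configurations compatible with this form a star-shaped set (`starConvex_swapRegion`), which also
contains the move in the T where the upper point waits on the vertical segment (`joinedIn_lexBase`).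
Both moves are therefore homotopic.

Finally, any configuration in the T slides inside the T onto the horizontal bar
(`exists_joinedIn_tShape_lineTuples`), which removes the restriction to base configurations. -/

theorem OrdConf.joinedIn_of_segment_subset {S : Set (Fin n → Plane)}
    (hS : ∀ h ∈ S, Function.Injective h) {f g : OrdConf n Plane}
    (h : segment ℝ f.1 g.1 ⊆ S) : JoinedIn (Subtype.val ⁻¹' S) f g := by
  obtain ⟨p, hp⟩ := JoinedIn.of_segment_subset h
  exact ⟨⟨⟨fun t => ⟨p t, hS _ (hp t)⟩, by fun_prop⟩, by ext1; simp, by ext1; simp⟩, hp⟩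

/-- A star-shaped set is contractible, hence simply connected. This is the only source of homotopies
between planar motions and motions in the T: it suffices to fit both into one star-shaped set of
injective tuples. -/
theorem OrdConf.homotopic_of_starConvex {S : Set (Fin n → Plane)} {c : Fin n → Plane}
    (hS : StarConvex ℝ c S) (hinj : ∀ h ∈ S, Function.Injective h) {f g : OrdConf n Plane}
    (p q : Path f g) (hp : ∀ t, (p t).1 ∈ S) (hq : ∀ t, (q t).1 ∈ S) : p.Homotopic q := by
  have hf : f.1 ∈ S := by simpa using hp 0
  have hg : g.1 ∈ S := by simpa using hp 1
  have : ContractibleSpace S := hS.contractibleSpace ⟨_, hf⟩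
  let P : Path (⟨f.1, hf⟩ : S) ⟨g.1, hg⟩ :=
    ⟨⟨fun t => ⟨(p t).1, hp t⟩, by fun_prop⟩, Subtype.ext (by simp), Subtype.ext (by simp)⟩
  let Q : Path (⟨f.1, hf⟩ : S) ⟨g.1, hg⟩ :=
    ⟨⟨fun t => ⟨(q t).1, hq t⟩, by fun_prop⟩, Subtype.ext (by simp), Subtype.ext (by simp)⟩
  let ι : C(S, OrdConf n Plane) := ⟨fun h => ⟨h.1, hinj _ h.2⟩, by fun_prop⟩
  exact (SimplyConnectedSpace.paths_homotopic P Q).map ι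

/-! ### Homotopy classes of paths that stay in the T-shaped set -/

/-- A homotopy class of paths of planar configurations is *T-representable* if it contains a path
of configurations in the T-shaped set. -/
def IsTRep {f g : OrdConf n Plane} (q : Path.Homotopic.Quotient f g) : Prop :=
  ∃ p : Path f g, (∀ t i, (p t).1 i ∈ tShape) ∧ Path.Homotopic.Quotient.mk p = q

namespace IsTRep

variable {f g h : OrdConf n Plane} {q : Path.Homotopic.Quotient f g}
  {r : Path.Homotopic.Quotient g h}

theorem symm (hq : IsTRep q) : IsTRep q.symm := by
  obtain ⟨p, hp, rfl⟩ := hq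
  exact ⟨p.symm, fun t => hp _, rfl⟩

theorem trans (hq : IsTRep q) (hr : IsTRep r) : IsTRep (q.trans r) := by
  obtain ⟨p, hp, rfl⟩ := hq
  obtain ⟨p', hp', rfl⟩ := hr
  refine ⟨p.trans p', fun t i => ?_, rfl⟩
  rw [Path.trans_apply]
  split_ifs
  exacts [hp _ i, hp' _ i]

end IsTRep

theorem mem_tShape {p : Plane} :
    p ∈ tShape ↔ (-1 ≤ p.1 ∧ p.1 ≤ 1) ∧ p.2 = 0 ∨ p.1 = 0 ∧ 0 ≤ p.2 ∧ p.2 ≤ 1 := by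
  simp [tShape, mem_prod, mem_Icc]

/-! ### The lexicographic order on the points of a configuration -/

theorem toLex_lt_combo {p q p' q' : Plane} (h : toLex p < toLex q) (h' : toLex p' < toLex q')
    {a b : ℝ} (ha : 0 ≤ a) (hb : 0 ≤ b) (hab : a + b = 1) :
    toLex (a • p + b • p') < toLex (a • q + b • q') := by
  rw [Prod.Lex.toLex_lt_toLex] at h h' ⊢
  simp only [Prod.fst_add, Prod.smul_fst, smul_eq_mul, Prod.snd_add, Prod.smul_snd]
  rcases ha.eq_or_lt with rfl | ha
  · obtain rfl : b = 1 := by linarith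
    simpa using h'
  rcases hb.eq_or_lt with rfl | hb
  · obtain rfl : a = 1 := by linarith
    simpa using h
  rcases h with h | ⟨h1, h2⟩ <;> rcases h' with h' | ⟨h1', h2'⟩
  · left; nlinarith
  · left; rw [h1']; nlinarith
  · left; rw [h1]; nlinarith
  · right; rw [h1, h1']; exact ⟨rfl, by nlinarith⟩

theorem toLex_lt_or_lt {f : Fin n → Plane} (hf : Function.Injective f) {k l : Fin n}
    (h : k ≠ l) : toLex (f k) < toLex (f l) ∨ toLex (f l) < toLex (f k) :=
  lt_or_gt_of_ne fun e => h (hf (toLex.injective e))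

/-- The tuples whose points are in the same lexicographic order as those of `f`. -/
def lexCell (f : Fin n → Plane) : Set (Fin n → Plane) :=
  {h | ∀ k l, toLex (f k) < toLex (f l) → toLex (h k) < toLex (h l)}

theorem self_mem_lexCell (f : Fin n → Plane) : f ∈ lexCell f := fun _ _ => id

theorem convex_lexCell (f : Fin n → Plane) : Convex ℝ (lexCell f) :=
  fun _ hx _ hy _ _ ha hb hab k l h => toLex_lt_combo (hx k l h) (hy k l h) ha hb hab

theorem injective_of_mem_lexCell {f h : Fin n → Plane} (hf : Function.Injective f)
    (hh : h ∈ lexCell f) : Function.Injective h := by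
  intro k l e
  by_contra hkl
  rcases toLex_lt_or_lt hf hkl with h' | h'
  · exact (hh _ _ h').ne (by rw [e])
  · exact (hh _ _ h').ne (by rw [e])

/-- The position of the `k`-th point in the lexicographic order, normalised to lie in `(0, 1)`. -/
noncomputable def lexPos (f : Fin n → Plane) (k : Fin n) : ℝ :=
  ((Finset.univ.filter fun l => toLex (f l) < toLex (f k)).card + 1) / (n + 1)

theorem lexPos_pos (f : Fin n → Plane) (k : Fin n) : 0 < lexPos f k := by
  unfold lexPos; positivity

theorem lexPos_lt_one (f : Fin n → Plane) (k : Fin n) : lexPos f k < 1 := by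
  unfold lexPos
  rw [div_lt_one (by positivity)]
  have : (Finset.univ.filter fun l => toLex (f l) < toLex (f k)).card < n := by
    refine (Finset.card_lt_univ_of_notMem (x := k) (by simp)).trans_eq (by simp)
  have : ((Finset.univ.filter fun l => toLex (f l) < toLex (f k)).card : ℝ) < n := by
    exact_mod_cast this
  linarith

theorem lexPos_lt {f : Fin n → Plane} {k l : Fin n} (h : toLex (f k) < toLex (f l)) :
    lexPos f k < lexPos f l := by
  unfold lexPos
  refine div_lt_div_of_pos_right ?_ (by positivity)
  have : (Finset.univ.filter fun m => toLex (f m) < toLex (f k)).card <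
      (Finset.univ.filter fun m => toLex (f m) < toLex (f l)).card := by
    refine Finset.card_lt_card (Finset.ssubset_iff_of_subset ?_ |>.2 ⟨k, by simpa using h, by simp⟩)
    exact Finset.monotone_filter_right _ fun m _ hm => hm.trans h
  have : ((Finset.univ.filter fun m => toLex (f m) < toLex (f k)).card : ℝ) <
      (Finset.univ.filter fun m => toLex (f m) < toLex (f l)).card := by
    exact_mod_cast this
  linarith

/-- The configuration on the horizontal segment with the same lexicographic order as `f`. -/
noncomputable def lexBase (f : OrdConf n Plane) : OrdConf n Plane :=
  ⟨fun k => (lexPos f.1 k, 0), injective_of_mem_lexCell f.2 (f := f.1) fun _ _ h =>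
    Prod.Lex.toLex_lt_toLex.2 (Or.inl (lexPos_lt h))⟩

theorem lexBase_mem_lexCell (f : OrdConf n Plane) : (lexBase f).1 ∈ lexCell f.1 :=
  fun _ _ h => Prod.Lex.toLex_lt_toLex.2 (Or.inl (lexPos_lt h))

/-- The tuples on the horizontal segment of the T-shaped set. -/
def lineTuples (n : ℕ) : Set (Fin n → Plane) :=
  {h | ∀ k, h k ∈ Icc (-1 : ℝ) 1 ×ˢ {(0 : ℝ)}}

theorem convex_lineTuples : Convex ℝ (lineTuples n) := by
  intro x hx y hy a b ha hb hab k
  exact ((convex_Icc _ _).prod (convex_singleton _)) (hx k) (hy k) ha hb hab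

theorem lexBase_mem_lineTuples (f : OrdConf n Plane) : (lexBase f).1 ∈ lineTuples n := fun k =>
  ⟨⟨(neg_one_lt_zero.trans (lexPos_pos f.1 k)).le, (lexPos_lt_one f.1 k).le⟩, rfl⟩

theorem joinedIn_lexCell {f g h : OrdConf n Plane} (hg : g.1 ∈ lexCell f.1)
    (hh : h.1 ∈ lexCell f.1) :
    JoinedIn (Subtype.val ⁻¹' lexCell f.1 : Set (OrdConf n Plane)) g h :=
  OrdConf.joinedIn_of_segment_subset (fun _ => injective_of_mem_lexCell f.2)
    ((convex_lexCell _).segment_subset hg hh)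

/-- A path in the lexicographic cell of `f` to the base configuration of that cell. -/
noncomputable def toLexBase (f : OrdConf n Plane) : Path f (lexBase f) :=
  (joinedIn_lexCell (self_mem_lexCell f.1) (lexBase_mem_lexCell f)).somePath

theorem toLexBase_mem (f : OrdConf n Plane) (t : I) : (toLexBase f t).1 ∈ lexCell f.1 :=
  (joinedIn_lexCell (self_mem_lexCell f.1) (lexBase_mem_lexCell f)).somePath_mem t

/-- Line configurations with the same order are joined by a path of line configurations. -/
theorem joinedIn_lineTuples {f g h : OrdConf n Plane} (hg : g.1 ∈ lexCell f.1)
    (hh : h.1 ∈ lexCell f.1) (hg' : g.1 ∈ lineTuples n) (hh' : h.1 ∈ lineTuples n) :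
    JoinedIn (Subtype.val ⁻¹' (lexCell f.1 ∩ lineTuples n) : Set (OrdConf n Plane)) g h :=
  OrdConf.joinedIn_of_segment_subset (fun _ h => injective_of_mem_lexCell f.2 h.1)
    (((convex_lexCell _).inter convex_lineTuples).segment_subset ⟨hg, hg'⟩ ⟨hh, hh'⟩)

theorem mem_tShape_of_mem_lineTuples {h : Fin n → Plane} (hh : h ∈ lineTuples n) (i : Fin n) :
    h i ∈ tShape := Or.inl (hh i)

/-! ### Good homotopy classes -/

/-- The homotopy class of paths between base configurations that corresponds to `q`. -/
noncomputable def toBaseClass {f g : OrdConf n Plane} (q : Path.Homotopic.Quotient f g) :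
    Path.Homotopic.Quotient (lexBase f) (lexBase g) :=
  ((Path.Homotopic.Quotient.mk (toLexBase f)).symm.trans q).trans (Path.Homotopic.Quotient.mk (toLexBase g))

section
variable {f g h : OrdConf n Plane}

theorem toBaseClass_trans (q : Path.Homotopic.Quotient f g) (r : Path.Homotopic.Quotient g h) :
    toBaseClass (q.trans r) = (toBaseClass q).trans (toBaseClass r) := by
  simp only [toBaseClass, Path.Homotopic.Quotient.trans_assoc]
  rw [← Path.Homotopic.Quotient.trans_assoc (Path.Homotopic.Quotient.mk (toLexBase g)),
    Path.Homotopic.Quotient.trans_symm, Path.Homotopic.Quotient.refl_trans]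

theorem toBaseClass_symm (q : Path.Homotopic.Quotient f g) :
    toBaseClass q.symm = (toBaseClass q).symm := by
  induction q using Path.Homotopic.Quotient.ind with | mk q => ?_
  simp only [toBaseClass, ← Path.Homotopic.Quotient.mk_symm, ← Path.Homotopic.Quotient.mk_trans,
    Path.trans_symm, Path.symm_symm]
  simp only [Path.Homotopic.Quotient.mk_trans, Path.Homotopic.Quotient.trans_assoc]

end

/-- If the base configurations of two configurations in a star-shaped set are joined, within this
set, by a path in the T-shaped set, then all paths within this set are T-representable. -/
theorem isTRep_toBaseClass_of_starConvex {S : Set (Fin n → Plane)} {c : Fin n → Plane}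
    (hS : StarConvex ℝ c S) (hinj : ∀ h ∈ S, Function.Injective h) {f g : OrdConf n Plane}
    (hf : JoinedIn (Subtype.val ⁻¹' (lexCell f.1 ∩ S) : Set (OrdConf n Plane)) f (lexBase f))
    (hg : JoinedIn (Subtype.val ⁻¹' (lexCell g.1 ∩ S) : Set (OrdConf n Plane)) g (lexBase g))
    (hb : JoinedIn {h : OrdConf n Plane | h.1 ∈ S ∧ ∀ i, h.1 i ∈ tShape} (lexBase f) (lexBase g))
    (p : Path f g) (hp : ∀ t, (p t).1 ∈ S) :
    IsTRep (toBaseClass (Path.Homotopic.Quotient.mk p)) := by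
  obtain ⟨b, hb⟩ := hb
  obtain ⟨a, ha⟩ := hf
  obtain ⟨d, hd⟩ := hg
  -- `toLexBase` is an arbitrary choice and may leave `S`. Convexity of the cell allows replacing it
  -- by `a`, and likewise by `d` at the other end, which stay in `S`.
  have hfa : (toLexBase f).Homotopic a :=
    OrdConf.homotopic_of_starConvex ((convex_lexCell f.1).starConvex (self_mem_lexCell _))
      (fun _ => injective_of_mem_lexCell f.2) _ _ (toLexBase_mem f) fun t => (ha t).1
  have hgd : (toLexBase g).Homotopic d :=
    OrdConf.homotopic_of_starConvex ((convex_lexCell g.1).starConvex (self_mem_lexCell _))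
      (fun _ => injective_of_mem_lexCell g.2) _ _ (toLexBase_mem g) fun t => (hd t).1
  refine ⟨b, fun t => (hb t).2, ?_⟩
  rw [toBaseClass, Path.Homotopic.Quotient.eq.2 hfa, Path.Homotopic.Quotient.eq.2 hgd,
    ← Path.Homotopic.Quotient.mk_symm, ← Path.Homotopic.Quotient.mk_trans,
    ← Path.Homotopic.Quotient.mk_trans, Path.Homotopic.Quotient.eq]
  refine OrdConf.homotopic_of_starConvex hS hinj _ _ (fun t => (hb t).1) fun t => ?_
  simp only [Path.trans_apply, Path.symm_apply]
  split_ifs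
  exacts [(ha _).2, hp _, (hd _).2]

theorem isTRep_toBaseClass_of_mem_lexCell {f g : OrdConf n Plane} (p : Path f g)
    (hp : ∀ t, (p t).1 ∈ lexCell f.1) : IsTRep (toBaseClass (Path.Homotopic.Quotient.mk p)) := by
  have hg : g.1 ∈ lexCell f.1 := by simpa using hp 1
  have hgf : lexCell g.1 ⊆ lexCell f.1 := fun h hh k l hkl => hh _ _ (hg _ _ hkl)
  refine isTRep_toBaseClass_of_starConvex ((convex_lexCell f.1).starConvex (self_mem_lexCell _))
    (fun _ => injective_of_mem_lexCell f.2) ?_ ?_ ?_ p hp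
  · exact (joinedIn_lexCell (self_mem_lexCell f.1) (lexBase_mem_lexCell f)).mono
      fun h hh => ⟨hh, hh⟩
  · exact (joinedIn_lexCell (self_mem_lexCell g.1) (lexBase_mem_lexCell g)).mono
      fun h hh => ⟨hh, hgf hh⟩
  exact (joinedIn_lineTuples (lexBase_mem_lexCell f) (hgf (lexBase_mem_lexCell g))
    (lexBase_mem_lineTuples f) (lexBase_mem_lineTuples g)).mono
    fun h hh => ⟨hh.1, mem_tShape_of_mem_lineTuples hh.2⟩

/-! ### Exchanging two neighbouring points -/

/-- The lexicographic order of `g` is obtained from that of `f` by exchanging the neighbouring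
points `i` and `j`, where `i` precedes `j` in `f`. -/
structure IsLexSwap (f g : Fin n → Plane) (i j : Fin n) : Prop where
  lt : toLex (f i) < toLex (f j)
  gt : toLex (g j) < toLex (g i)
  iff : ∀ k l, ¬(k = i ∧ l = j) → ¬(k = j ∧ l = i) →
    (toLex (f k) < toLex (f l) ↔ toLex (g k) < toLex (g l))

/-- The tuples in the same lexicographic order as `f` except possibly for the points `i` and `j`,
such that `i` is not vertically below `j`. -/
def swapRegion (f : Fin n → Plane) (i j : Fin n) : Set (Fin n → Plane) :=
  {h | (∀ k l, toLex (f k) < toLex (f l) → ¬(k = i ∧ l = j) → toLex (h k) < toLex (h l)) ∧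
    ¬((h i).1 = (h j).1 ∧ (h i).2 ≤ (h j).2)}

theorem injective_of_mem_swapRegion {f h : Fin n → Plane} {i j : Fin n}
    (hf : Function.Injective f) (hh : h ∈ swapRegion f i j) : Function.Injective h := by
  have key : ∀ k l, toLex (f k) < toLex (f l) → h k ≠ h l := by
    intro k l hkl e
    by_cases hc : k = i ∧ l = j
    · obtain ⟨rfl, rfl⟩ := hc
      exact hh.2 ⟨by rw [e], by rw [e]⟩
    · exact (hh.1 k l hkl hc).ne (by rw [e])
  intro k l e
  by_contra hkl
  rcases toLex_lt_or_lt hf hkl with h' | h'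
  exacts [key _ _ h' e, key _ _ h' e.symm]

theorem fst_lt_of_mem_lineTuples {h : Fin n → Plane} (hh : h ∈ lineTuples n) {k l : Fin n}
    (hkl : toLex (h k) < toLex (h l)) : (h k).1 < (h l).1 := by
  rcases Prod.Lex.toLex_lt_toLex.1 hkl with h' | h'
  · exact h'
  · exact absurd h'.2 (by rw [(hh k).2, (hh l).2]; exact lt_irrefl _)

namespace IsLexSwap

variable {f g : Fin n → Plane} {i j : Fin n}

theorem symm (hs : IsLexSwap f g i j) : IsLexSwap g f j i :=
  ⟨hs.gt, hs.lt, fun k l h h' => (hs.iff k l h' h).symm⟩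

theorem ne (hs : IsLexSwap f g i j) : i ≠ j := by
  rintro rfl; exact lt_irrefl _ hs.lt

theorem lt_left (hs : IsLexSwap f g i j) {k : Fin n} (hk : k ≠ i)
    (h : toLex (f k) < toLex (f j)) : toLex (f k) < toLex (f i) := by
  have hkj : k ≠ j := by rintro rfl; exact lt_irrefl _ h
  have h1 := (hs.iff k j (by tauto) (by tauto)).1 h
  exact (hs.iff k i (by tauto) (by tauto)).2 (h1.trans hs.gt)

theorem mem_swapRegion_of_mem_lexCell {h : Fin n → Plane} (hh : h ∈ lexCell f)
    (hij : (h i).1 < (h j).1) : h ∈ swapRegion f i j :=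
  ⟨fun k l hkl _ => hh k l hkl, fun h => hij.ne h.1⟩

/-- When `j` precedes `i` lexicographically and they share a vertical line, `i` is the upper point,
which the region allows. In the cell of `f` such a pair has `i` below, so there a strict horizontal
inequality must be required. -/
theorem lexCell_right_subset (hs : IsLexSwap f g i j) : lexCell g ⊆ swapRegion f i j := by
  refine fun h hh => ⟨fun k l hkl hne => hh k l ((hs.iff k l hne ?_).1 hkl), fun hij => ?_⟩
  · rintro ⟨rfl, rfl⟩
    exact hkl.not_gt hs.lt
  · rcases Prod.Lex.toLex_lt_toLex.1 (hh _ _ hs.gt) with h' | h'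
    · exact h'.ne' hij.1
    · exact h'.2.not_ge hij.2

theorem mem_lexCell_left {h : Fin n → Plane} (hh : h ∈ swapRegion f i j)
    (hij : toLex (h i) < toLex (h j)) : h ∈ lexCell f := by
  intro k l hkl
  by_cases hc : k = i ∧ l = j
  · rwa [hc.1, hc.2]
  · exact hh.1 k l hkl hc

theorem mem_lexCell_right (hs : IsLexSwap f g i j) {h : Fin n → Plane}
    (hh : h ∈ swapRegion f i j) (hij : toLex (h j) < toLex (h i)) : h ∈ lexCell g := by
  intro k l hkl
  by_cases hc : k = j ∧ l = i
  · rwa [hc.1, hc.2]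
  · have hne : ¬(k = i ∧ l = j) := by
      rintro ⟨rfl, rfl⟩
      exact hkl.not_gt hs.gt
    exact hh.1 k l ((hs.iff k l hne hc).2 hkl) hne

/-- The centre of the star-shaped set `swapRegion f i j`: the point `i` is above the point `j`. -/
noncomputable def center (f : Fin n → Plane) (i j : Fin n) (k : Fin n) : Plane :=
  if k = i then (lexPos f i, 1) else if k = j then (lexPos f i, 0) else (lexPos f k, 0)

/-- Placing `j` in the column of `i` disturbs no other comparison, because `i` and `j` are
neighbours: by `lt_left`, whatever precedes `j` also precedes `i`. -/
theorem center_lt (hs : IsLexSwap f g i j) {k l : Fin n} (hkl : toLex (f k) < toLex (f l))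
    (hne : ¬(k = i ∧ l = j)) : (center f i j k).1 < (center f i j l).1 := by
  have hij := hs.ne
  by_cases hli : l = i
  · subst hli
    have h1 : k ≠ l := by rintro rfl; exact lt_irrefl _ hkl
    have h2 : k ≠ j := by rintro rfl; exact hkl.not_gt hs.lt
    simpa [center, h1, h2] using lexPos_lt hkl
  by_cases hki : k = i
  · subst hki
    have h2 : l ≠ j := fun h => hne ⟨rfl, h⟩
    simpa [center, hli, h2] using lexPos_lt hkl
  by_cases hlj : l = j
  · subst hlj
    have h1 : k ≠ l := by rintro rfl; exact lt_irrefl _ hkl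
    simpa [center, hli, hki, h1] using lexPos_lt (hs.lt_left hki hkl)
  by_cases hkj : k = j
  · subst hkj
    simpa [center, hki, hli, hlj] using lexPos_lt (hs.lt.trans hkl)
  simpa [center, hki, hli, hlj, hkj] using lexPos_lt hkl

/-- The difference of the points `i` and `j` must avoid a closed vertical half-line ending at the
origin, and a slit plane is star-shaped about any point of the opposite half-line. At the centre
this difference is `(0, 1)`. The remaining conditions are preserved by convex combinations. -/
theorem starConvex_swapRegion (hs : IsLexSwap f g i j) :
    StarConvex ℝ (center f i j) (swapRegion f i j) := by
  intro h hh a b ha hb hab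
  refine ⟨fun k l hkl hne => ?_, ?_⟩
  · exact toLex_lt_combo (Prod.Lex.toLex_lt_toLex.2 (Or.inl (hs.center_lt hkl hne)))
      (hh.1 k l hkl hne) ha hb hab
  · rintro ⟨h1, h2⟩
    simp [center, hs.ne.symm] at h1 h2
    rcases hb.eq_or_lt with rfl | hb
    · linarith
    · refine hh.2 ⟨h1.resolve_right hb.ne', ?_⟩
      nlinarith

/-- The configuration in the T-shaped set with the point `i` at height `u` on the vertical segment,
the point `j` at position `v` on the horizontal segment, and the others out of the way. -/
noncomputable def junction (f : Fin n → Plane) (i j : Fin n) (u v : ℝ) (k : Fin n) : Plane :=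
  if k = i then (0, u) else if k = j then (v, 0) else
    if toLex (f k) < toLex (f i) then (lexPos f k / 2 - 1, 0) else (lexPos f k / 2 + 1 / 2, 0)

/-- The bystanders lie in the open intervals from `-1` to `-1/2` and from `1/2` to `1`, clear of
both `i` at abscissa `0` and `j` at abscissa `v`. The only danger is `i` meeting `j` at the origin.
-/
theorem junction_mem_swapRegion (hs : IsLexSwap f g i j) {u v : ℝ} (hu : 0 ≤ u)
    (hv : v ∈ Icc (-(1 / 2) : ℝ) (1 / 2)) (huv : v = 0 → u ≠ 0) :
    junction f i j u v ∈ swapRegion f i j := by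
  have hij := hs.ne
  obtain ⟨hv1, hv2⟩ := hv
  refine ⟨fun k l hkl hne => Prod.Lex.toLex_lt_toLex.2 (Or.inl ?_), ?_⟩
  · have pk := lexPos_pos f k
    have pl := lexPos_pos f l
    have pk' := lexPos_lt_one f k
    have pl' := lexPos_lt_one f l
    by_cases hli : l = i
    · subst hli
      have h1 : k ≠ l := by rintro rfl; exact lt_irrefl _ hkl
      have h2 : k ≠ j := by rintro rfl; exact hkl.not_gt hs.lt
      simp only [junction, h1, h2, hkl, if_true, if_false]
      linarith
    by_cases hki : k = i
    · subst hki
      have h2 : l ≠ j := fun h => hne ⟨rfl, h⟩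
      simp only [junction, hli, h2, hkl.not_gt, if_true, if_false]
      linarith
    by_cases hlj : l = j
    · subst hlj
      have h1 : k ≠ l := by rintro rfl; exact lt_irrefl _ hkl
      simp only [junction, hli, hki, h1, hs.lt_left hki hkl, if_true, if_false]
      linarith
    by_cases hkj : k = j
    · subst hkj
      simp only [junction, hki, hli, hlj, (hs.lt.trans hkl).not_gt, if_true, if_false]
      linarith
    have := lexPos_lt hkl
    by_cases h1 : toLex (f l) < toLex (f i)
    · simp only [junction, hki, hli, hlj, hkj, h1, hkl.trans h1, if_true, if_false]
      linarith
    · by_cases h2 : toLex (f k) < toLex (f i) <;>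
      · simp only [junction, hki, hli, hlj, hkj, h1, h2, if_true, if_false]
        linarith
  · rintro ⟨h1, h2⟩
    simp only [junction, hij.symm, if_true, if_false] at h1 h2
    exact huv h1.symm (le_antisymm h2 hu)

theorem junction_mem_tShape (f : Fin n → Plane) (i j : Fin n) {u v : ℝ} (hu : u ∈ Icc (0 : ℝ) 1)
    (hv : v ∈ Icc (-(1 / 2) : ℝ) (1 / 2)) (k : Fin n) : junction f i j u v k ∈ tShape := by
  have pk := lexPos_pos f k
  have pk' := lexPos_lt_one f k
  rw [mem_tShape]
  unfold junction
  split_ifs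
  · right; exact ⟨rfl, hu⟩
  · left; exact ⟨⟨by linarith [hv.1], by linarith [hv.2]⟩, rfl⟩
  · left; exact ⟨⟨by dsimp only; linarith, by dsimp only; linarith⟩, rfl⟩
  · left; exact ⟨⟨by dsimp only; linarith, by dsimp only; linarith⟩, rfl⟩

theorem junction_zero_mem_lineTuples (f : Fin n → Plane) (i j : Fin n) {v : ℝ}
    (hv : v ∈ Icc (-(1 / 2) : ℝ) (1 / 2)) : junction f i j 0 v ∈ lineTuples n := by
  intro k
  have pk := lexPos_pos f k
  have pk' := lexPos_lt_one f k
  unfold junction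
  split_ifs
  · exact ⟨by norm_num, rfl⟩
  · exact ⟨⟨by linarith [hv.1], by linarith [hv.2]⟩, rfl⟩
  · exact ⟨⟨by dsimp only; linarith, by dsimp only; linarith⟩, rfl⟩
  · exact ⟨⟨by dsimp only; linarith, by dsimp only; linarith⟩, rfl⟩

/-- The base configurations of `f` and `g` are joined by a path in the T-shaped set during which
the point `i` waits on the vertical segment while `j` passes below it. -/
theorem joinedIn_lexBase {f g : OrdConf n Plane} (hs : IsLexSwap f.1 g.1 i j) :
    JoinedIn {h : OrdConf n Plane | h.1 ∈ swapRegion f.1 i j ∧ ∀ i, h.1 i ∈ tShape}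
      (lexBase f) (lexBase g) := by
  -- Along the half-turn `u = sin πt`, `v = cos πt / 2`, the point `j` goes from `1/2` to `-1/2`
  -- while `i` rises and returns. Sine and cosine never vanish together, so they do not collide.
  have hsin : ∀ t : I, Real.sin (Real.pi * t) ∈ Icc (0 : ℝ) 1 := fun t =>
    ⟨Real.sin_nonneg_of_nonneg_of_le_pi (mul_nonneg Real.pi_pos.le t.2.1)
      (mul_le_of_le_one_right Real.pi_pos.le t.2.2), Real.sin_le_one _⟩
  have hcos : ∀ t : I, Real.cos (Real.pi * t) / 2 ∈ Icc (-(1 / 2) : ℝ) (1 / 2) := fun t =>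
    ⟨by linarith [Real.neg_one_le_cos (Real.pi * t)], by linarith [Real.cos_le_one (Real.pi * t)]⟩
  have hmem : ∀ t : I, junction f.1 i j (Real.sin (Real.pi * t)) (Real.cos (Real.pi * t) / 2) ∈
      swapRegion f.1 i j := fun t => by
    refine hs.junction_mem_swapRegion (hsin t).1 (hcos t) fun h h' => ?_
    have := Real.sin_sq_add_cos_sq (Real.pi * t)
    rw [h', show Real.cos (Real.pi * t) = 0 by linarith] at this
    norm_num at this
  have h0 : junction f.1 i j 0 (1 / 2) ∈ swapRegion f.1 i j :=
    hs.junction_mem_swapRegion le_rfl (by norm_num) (by norm_num)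
  have h1 : junction f.1 i j 0 (-(1 / 2)) ∈ swapRegion f.1 i j :=
    hs.junction_mem_swapRegion le_rfl (by norm_num) (by norm_num)
  let x : OrdConf n Plane := ⟨_, injective_of_mem_swapRegion f.2 h0⟩
  let y : OrdConf n Plane := ⟨_, injective_of_mem_swapRegion f.2 h1⟩
  have hx : x.1 ∈ lexCell f.1 := by
    refine mem_lexCell_left h0 (Prod.Lex.toLex_lt_toLex.2 (Or.inl ?_))
    simp [x, junction, hs.ne.symm]
  have hy : y.1 ∈ lexCell g.1 := by
    refine hs.mem_lexCell_right h1 (Prod.Lex.toLex_lt_toLex.2 (Or.inl ?_))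
    simp [y, junction, hs.ne.symm]
  have J1 := joinedIn_lineTuples (lexBase_mem_lexCell f) hx (lexBase_mem_lineTuples f)
    (junction_zero_mem_lineTuples f.1 i j (by norm_num))
  have J3 := joinedIn_lineTuples hy (lexBase_mem_lexCell g)
    (junction_zero_mem_lineTuples f.1 i j (by norm_num)) (lexBase_mem_lineTuples g)
  have J2 : JoinedIn {h : OrdConf n Plane | h.1 ∈ swapRegion f.1 i j ∧ ∀ i, h.1 i ∈ tShape}
      x y := by
    refine ⟨⟨⟨fun t => ⟨_, injective_of_mem_swapRegion f.2 (hmem t)⟩, ?_⟩,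
      Subtype.ext (by simp [x]), Subtype.ext (by simp [y, neg_div])⟩,
      fun t => ⟨hmem t, junction_mem_tShape _ _ _ (hsin t) (hcos t)⟩⟩
    refine Continuous.subtype_mk (continuous_pi fun k => ?_) _
    unfold junction
    split_ifs <;> fun_prop
  refine (JoinedIn.mono J1 fun h hh => ?_).trans (J2.trans (JoinedIn.mono J3 fun h hh => ?_))
  · exact ⟨mem_swapRegion_of_mem_lexCell hh.1 (fst_lt_of_mem_lineTuples hh.2 (hh.1 _ _ hs.lt)),
      mem_tShape_of_mem_lineTuples hh.2⟩
  · exact ⟨hs.lexCell_right_subset hh.1, mem_tShape_of_mem_lineTuples hh.2⟩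

/-- Moving the point `i` above its neighbour `j` from left to right is T-representable. -/
theorem isTRep_toBaseClass {f g : OrdConf n Plane} (hs : IsLexSwap f.1 g.1 i j)
    (hf : (f.1 i).1 < (f.1 j).1) (p : Path f g) (hp : ∀ t, (p t).1 ∈ swapRegion f.1 i j) :
    IsTRep (toBaseClass (Path.Homotopic.Quotient.mk p)) := by
  refine isTRep_toBaseClass_of_starConvex hs.starConvex_swapRegion
    (fun _ => injective_of_mem_swapRegion f.2) ?_ ?_ hs.joinedIn_lexBase p hp
  -- The cell of `f` is not contained in the swap region, but its intersection with this open
  -- half-space is, and that intersection is still convex.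
  · have hc : Convex ℝ {h : Fin n → Plane | (h i).1 < (h j).1} := fun x hx y hy a b ha hb hab => by
      simp only [mem_ofPred_eq, Pi.add_apply, Pi.smul_apply, Prod.fst_add, Prod.smul_fst,
        smul_eq_mul] at hx hy ⊢
      rcases ha.eq_or_lt with rfl | ha
      · obtain rfl : b = 1 := by linarith
        simpa using hy
      · nlinarith
    refine (OrdConf.joinedIn_of_segment_subset (fun _ h => injective_of_mem_lexCell f.2 h.1)
      (((convex_lexCell f.1).inter hc).segment_subset ⟨self_mem_lexCell _, hf⟩
        ⟨lexBase_mem_lexCell f, lexPos_lt hs.lt⟩)).mono fun h hh =>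
          ⟨hh.1, mem_swapRegion_of_mem_lexCell hh.1 hh.2⟩
  · exact (joinedIn_lexCell (self_mem_lexCell g.1) (lexBase_mem_lexCell g)).mono
      fun h hh => ⟨hh, hs.lexCell_right_subset hh⟩

end IsLexSwap

/-! ### Local T-representability -/

theorem lexPos_lt_iff {f : Fin n → Plane} {k l : Fin n} :
    lexPos f k < lexPos f l ↔ toLex (f k) < toLex (f l) := by
  refine ⟨fun h => ?_, lexPos_lt⟩
  by_contra h'
  rcases (not_lt.1 h').lt_or_eq with h1 | h1
  · exact h.not_gt (lexPos_lt h1)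
  · exact h.ne (by rw [lexPos, lexPos, h1])

theorem lexPos_injective {f : Fin n → Plane} (hf : Function.Injective f) :
    Function.Injective (lexPos f) := by
  intro k l h
  by_contra hkl
  rcases toLex_lt_or_lt hf hkl with h' | h'
  exacts [(lexPos_lt h').ne h, (lexPos_lt h').ne' h]

/-- Two neighbouring points can be exchanged by changing only the horizontal coordinates. -/
theorem exists_isLexSwap (g : OrdConf n Plane) {i j : Fin n} (hij : toLex (g.1 i) < toLex (g.1 j))
    (hadj : ∀ k, toLex (g.1 i) < toLex (g.1 k) → ¬toLex (g.1 k) < toLex (g.1 j)) :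
    ∃ g' : OrdConf n Plane, IsLexSwap g.1 g'.1 i j ∧ (∀ k, (g'.1 k).2 = (g.1 k).2) ∧
      ∀ k l, toLex (g'.1 k) < toLex (g'.1 l) → (g'.1 k).1 < (g'.1 l).1 := by
  have hinj : Function.Injective fun k => lexPos g.1 (Equiv.swap i j k) :=
    (lexPos_injective g.2).comp (Equiv.injective _)
  -- The new abscissae are the ranks with those of `i` and `j` exchanged. They are distinct, so they
  -- alone decide the new order.
  let G : Fin n → Plane := fun k => (lexPos g.1 (Equiv.swap i j k), (g.1 k).2)
  have hG : ∀ k l, toLex (G k) < toLex (G l) ↔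
      toLex (g.1 (Equiv.swap i j k)) < toLex (g.1 (Equiv.swap i j l)) := by
    intro k l
    rw [Prod.Lex.toLex_lt_toLex, ← lexPos_lt_iff]
    refine ⟨fun h => h.elim id fun h => ?_, Or.inl⟩
    obtain rfl := hinj h.1
    exact absurd h.2 (lt_irrefl _)
  have hne : i ≠ j := by rintro rfl; exact lt_irrefl _ hij
  have h1 : ∀ l, l ≠ i → l ≠ j → (toLex (g.1 i) < toLex (g.1 l) ↔ toLex (g.1 j) < toLex (g.1 l)) :=
    fun l _ hlj => ⟨fun h => (toLex_lt_or_lt g.2 hlj).resolve_left (hadj l h), hij.trans⟩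
  have h2 : ∀ l, l ≠ i → l ≠ j → (toLex (g.1 l) < toLex (g.1 i) ↔ toLex (g.1 l) < toLex (g.1 j)) :=
    fun l hli _ => ⟨fun h => h.trans hij,
      fun h => (toLex_lt_or_lt g.2 hli).resolve_right fun h' => hadj l h' h⟩
  refine ⟨⟨G, fun k l h => hinj (congrArg Prod.fst h)⟩, ⟨hij, ?_, fun k l hkl hlk => ?_⟩,
    fun _ => rfl, fun k l h => lexPos_lt ((hG k l).1 h)⟩
  · rw [hG]; simpa using hij
  · rw [hG]
    by_cases hki : k = i
    · subst hki
      have hlj : l ≠ j := fun h => hkl ⟨rfl, h⟩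
      by_cases hli : l = k
      · subst hli; simp
      · rw [Equiv.swap_apply_left, Equiv.swap_apply_of_ne_of_ne hli hlj, h1 l hli hlj]
    by_cases hkj : k = j
    · subst hkj
      have hli : l ≠ i := fun h => hlk ⟨rfl, h⟩
      by_cases hlj : l = k
      · subst hlj; simp
      · rw [Equiv.swap_apply_right, Equiv.swap_apply_of_ne_of_ne hli hlj, h1 l hli hlj]
    rw [Equiv.swap_apply_of_ne_of_ne hki hkj]
    by_cases hli : l = i
    · subst hli
      rw [Equiv.swap_apply_left, h2 k hki hkj]
    by_cases hlj : l = j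
    · subst hlj
      rw [Equiv.swap_apply_right, h2 k hki hkj]
    rw [Equiv.swap_apply_of_ne_of_ne hli hlj]

/-- Once `i` is strictly higher than `j`, the non-convex slit condition is automatic. -/
theorem IsLexSwap.convex_swapRegion_inter (f : Fin n → Plane) (i j : Fin n) :
    Convex ℝ (swapRegion f i j ∩ {h | (h j).2 < (h i).2}) := by
  intro x hx y hy a b ha hb hab
  have hlt : ((a • x + b • y) j).2 < ((a • x + b • y) i).2 := by
    have h1 : (x j).2 < (x i).2 := hx.2
    have h2 : (y j).2 < (y i).2 := hy.2
    simp only [Pi.add_apply, Pi.smul_apply, Prod.snd_add, Prod.smul_snd, smul_eq_mul]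
    rcases ha.eq_or_lt with rfl | ha
    · obtain rfl : b = 1 := by linarith
      simpa using h2
    · nlinarith
  exact ⟨⟨fun k l hkl hne => toLex_lt_combo (hx.1.1 k l hkl hne) (hy.1.1 k l hkl hne) ha hb hab,
    fun h => hlt.not_ge h.2⟩, hlt⟩

/-- The straight path that exchanges two neighbouring points, while keeping their vertical
coordinates distinct, is T-representable. -/
theorem IsLexSwap.exists_path_isTRep {g g' : OrdConf n Plane} {i j : Fin n}
    (hs : IsLexSwap g.1 g'.1 i j) (hy : ∀ k, (g'.1 k).2 = (g.1 k).2)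
    (hx : ∀ k l, toLex (g'.1 k) < toLex (g'.1 l) → (g'.1 k).1 < (g'.1 l).1)
    (hij : (g.1 i).2 ≠ (g.1 j).2) (p : Path g g') (hp : ∀ t, (p t).1 ∈ segment ℝ g.1 g'.1) :
    IsTRep (toBaseClass (Path.Homotopic.Quotient.mk p)) := by
  rcases hij.lt_or_gt with h | h
  -- Here `j` is the upper point and moves right to left. The reversed path moves it left to right
  -- above `i`, so the swap lemma applies with the roles exchanged.
  · suffices IsTRep (toBaseClass (Path.Homotopic.Quotient.mk p.symm)) by
      have := this.symm
      rwa [← toBaseClass_symm, ← Path.Homotopic.Quotient.mk_symm, Path.symm_symm] at this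
    refine hs.symm.isTRep_toBaseClass (hx _ _ hs.gt) _ fun t => ?_
    refine ((convex_swapRegion_inter g'.1 j i).segment_subset ⟨⟨fun k l hkl hne => ?_,
      fun h' => h.not_ge h'.2⟩, h⟩ ⟨⟨fun k l hkl _ => hkl, fun h' => ?_⟩, ?_⟩ (hp _)).1
    · refine (hs.iff k l ?_ hne).2 hkl
      rintro ⟨rfl, rfl⟩
      exact hkl.not_gt hs.gt
    · rw [hy, hy] at h'
      exact h.not_ge h'.2
    · simpa only [mem_ofPred_eq, hy] using h
  · refine hs.isTRep_toBaseClass ?_ _ fun t => ?_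
    · exact (Prod.Lex.toLex_lt_toLex.1 hs.lt).resolve_right fun h' => h.not_gt h'.2
    refine ((convex_swapRegion_inter g.1 i j).segment_subset ⟨⟨fun k l hkl _ => hkl,
      fun h' => h.not_ge h'.2⟩, h⟩ ⟨⟨fun k l hkl hne => ?_, fun h' => ?_⟩, ?_⟩ (hp _)).1
    · refine (hs.iff k l hne ?_).1 hkl
      rintro ⟨rfl, rfl⟩
      exact hkl.not_gt hs.lt
    · rw [hy, hy] at h'
      exact h.not_ge h'.2
    · simpa only [mem_ofPred_eq, hy] using h

/-- The tuples that satisfy all the strict inequalities between coordinates that `f` satisfies. -/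
def gridCell (f : Fin n → Plane) : Set (Fin n → Plane) :=
  {h | ∀ k l, ((f k).1 < (f l).1 → (h k).1 < (h l).1) ∧ ((f k).2 < (f l).2 → (h k).2 < (h l).2)}

theorem self_mem_gridCell (f : Fin n → Plane) : f ∈ gridCell f := fun _ _ => ⟨id, id⟩

theorem isOpen_gridCell (f : Fin n → Plane) : IsOpen (gridCell f) := by
  have : gridCell f = ⋂ k, ⋂ l, ({h | (f k).1 < (f l).1 → (h k).1 < (h l).1} ∩
      {h | (f k).2 < (f l).2 → (h k).2 < (h l).2}) := by
    ext h; simp [gridCell]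
  rw [this]
  refine isOpen_iInter_of_finite fun k => isOpen_iInter_of_finite fun l => IsOpen.inter ?_ ?_
  · by_cases h : (f k).1 < (f l).1
    · simpa only [h, true_imp_iff] using isOpen_lt (by fun_prop) (by fun_prop)
    · simp [h]
  · by_cases h : (f k).2 < (f l).2
    · simpa only [h, true_imp_iff] using isOpen_lt (by fun_prop) (by fun_prop)
    · simp [h]

theorem convex_gridCell (f : Fin n → Plane) : Convex ℝ (gridCell f) := by
  intro x hx y hy a b ha hb hab k l
  have key : ∀ {p q p' q' : ℝ}, p < q → p' < q' → a * p + b * p' < a * q + b * q' := by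
    intro p q p' q' h h'
    rcases ha.eq_or_lt with rfl | ha
    · obtain rfl : b = 1 := by linarith
      simpa using h'
    · nlinarith
  exact ⟨fun h => key ((hx k l).1 h) ((hy k l).1 h), fun h => key ((hx k l).2 h) ((hy k l).2 h)⟩

theorem injective_of_mem_gridCell {f h : Fin n → Plane} (hf : Function.Injective f)
    (hh : h ∈ gridCell f) : Function.Injective h := by
  intro k l e
  by_contra hkl
  refine hkl (hf (Prod.ext ?_ ?_)) <;> refine le_antisymm ?_ ?_ <;> by_contra h'
  · exact ((hh l k).1 (not_le.1 h')).ne (by rw [e])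
  · exact ((hh k l).1 (not_le.1 h')).ne (by rw [e])
  · exact ((hh l k).2 (not_le.1 h')).ne (by rw [e])
  · exact ((hh k l).2 (not_le.1 h')).ne (by rw [e])

theorem homotopic_of_mem_gridCell {f g h : OrdConf n Plane} (p q : Path g h)
    (hp : ∀ t, (p t).1 ∈ gridCell f.1) (hq : ∀ t, (q t).1 ∈ gridCell f.1) : p.Homotopic q :=
  OrdConf.homotopic_of_starConvex ((convex_gridCell f.1).starConvex (self_mem_gridCell _))
    (fun _ => injective_of_mem_gridCell f.2) p q hp hq

/-- The pairs of points that are in a different lexicographic order in `g` and in `h`. -/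
noncomputable def lexInv (g h : Fin n → Plane) : Finset (Fin n × Fin n) :=
  Finset.univ.filter fun p => toLex (g p.1) < toLex (g p.2) ∧ toLex (h p.2) < toLex (h p.1)

theorem mem_lexInv {g h : Fin n → Plane} {i j : Fin n} :
    (i, j) ∈ lexInv g h ↔ toLex (g i) < toLex (g j) ∧ toLex (h j) < toLex (h i) := by
  simp [lexInv]

/-- Take an inversion whose ranks in `g` are closest. A point `k` strictly between would form an
inversion with `i` or with `j`, at smaller distance. -/
theorem exists_adjacent_mem_lexInv {g h : Fin n → Plane} (hne : (lexInv g h).Nonempty) :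
    ∃ i j, (i, j) ∈ lexInv g h ∧ ∀ k, toLex (g i) < toLex (g k) → ¬toLex (g k) < toLex (g j) := by
  obtain ⟨⟨i, j⟩, hij, hmin⟩ :=
    Finset.exists_min_image _ (fun p => lexPos g p.2 - lexPos g p.1) hne
  refine ⟨i, j, hij, fun k hik hkj => ?_⟩
  rw [mem_lexInv] at hij
  have h1 := lexPos_lt hik
  have h2 := lexPos_lt hkj
  rcases lt_or_ge (toLex (h k)) (toLex (h i)) with hk | hk
  · have := hmin (i, k) (mem_lexInv.2 ⟨hik, hk⟩)
    dsimp only at this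
    linarith
  · have := hmin (k, j) (mem_lexInv.2 ⟨hkj, hij.2.trans_le hk⟩)
    dsimp only at this
    linarith

theorem IsLexSwap.card_lexInv_lt {g g' h : Fin n → Plane} {i j : Fin n} (hs : IsLexSwap g g' i j)
    (hij : (i, j) ∈ lexInv g h) : (lexInv g' h).card < (lexInv g h).card := by
  refine Finset.card_lt_card (Finset.ssubset_iff_of_subset ?_ |>.2 ⟨(i, j), hij, fun h' => ?_⟩)
  · rintro ⟨k, l⟩ hkl
    rw [mem_lexInv] at hkl ⊢ hij
    refine ⟨(hs.iff k l ?_ ?_).2 hkl.1, hkl.2⟩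
    · rintro ⟨rfl, rfl⟩
      exact hkl.1.not_gt hs.gt
    · rintro ⟨rfl, rfl⟩
      exact hkl.2.not_gt hij.2
  · exact (mem_lexInv.1 h').1.not_gt hs.gt

/-- Bubble sort by induction on the number of inversions. Without inversions the straight path stays
in one lexicographic cell. Otherwise a neighbouring inverted pair is exchanged first, inside the
grid cell. -/
theorem isTRep_toBaseClass_of_mem_gridCell (f : OrdConf n Plane) {g h : OrdConf n Plane}
    (p : Path g h) (hp : ∀ t, (p t).1 ∈ gridCell f.1) :
    IsTRep (toBaseClass (Path.Homotopic.Quotient.mk p)) := by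
  induction hN : (lexInv g.1 h.1).card using Nat.strong_induction_on generalizing g with
  | _ N ih =>
  have hg : g.1 ∈ gridCell f.1 := by simpa using hp 0
  have hh : h.1 ∈ gridCell f.1 := by simpa using hp 1
  have join : ∀ {x y : OrdConf n Plane}, x.1 ∈ gridCell f.1 → y.1 ∈ gridCell f.1 →
      ∃ q : Path x y, ∀ t, (q t).1 ∈ segment ℝ x.1 y.1 ∧ (q t).1 ∈ gridCell f.1 := by
    intro x y hx hy
    have hsub := (convex_gridCell f.1).segment_subset hx hy
    exact OrdConf.joinedIn_of_segment_subset (S := segment ℝ x.1 y.1 ∩ gridCell f.1)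
      (fun z hz => injective_of_mem_gridCell f.2 hz.2) fun z hz => ⟨hz, hsub hz⟩
  rcases (lexInv g.1 h.1).eq_empty_or_nonempty with he | hne
  · obtain ⟨q, hq⟩ := join hg hh
    rw [Path.Homotopic.Quotient.eq.2 (homotopic_of_mem_gridCell p q hp fun t => (hq t).2)]
    refine isTRep_toBaseClass_of_mem_lexCell q fun t =>
      (convex_lexCell g.1).segment_subset (self_mem_lexCell _) (fun k l hkl => ?_) (hq t).1
    have hne : k ≠ l := by rintro rfl; exact lt_irrefl _ hkl
    refine (toLex_lt_or_lt h.2 hne).resolve_right fun h' => ?_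
    have := mem_lexInv.2 ⟨hkl, h'⟩
    simp [he] at this
  · obtain ⟨i, j, hij, hadj⟩ := exists_adjacent_mem_lexInv hne
    have hij' := mem_lexInv.1 hij
    obtain ⟨g', hs, hy, hx⟩ := exists_isLexSwap g hij'.1 hadj
    -- A pair inverted within the grid cell must share its abscissa in `f`. Its heights in `f` then
    -- differ, and their order persists throughout the cell, so the exchange has a definite upper
    -- point.
    have hfx : (f.1 i).1 = (f.1 j).1 := by
      refine le_antisymm ?_ ?_ <;> by_contra h'
      · exact hij'.1.not_gt (Prod.Lex.toLex_lt_toLex.2 (Or.inl ((hg _ _).1 (not_le.1 h'))))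
      · exact hij'.2.not_gt (Prod.Lex.toLex_lt_toLex.2 (Or.inl ((hh _ _).1 (not_le.1 h'))))
    have hgy : (g.1 i).2 ≠ (g.1 j).2 := by
      have : (f.1 i).2 ≠ (f.1 j).2 := fun h' => hs.ne (f.2 (Prod.ext hfx h'))
      rcases this.lt_or_gt with h' | h'
      exacts [((hg _ _).2 h').ne, ((hg _ _).2 h').ne']
    have hg' : g'.1 ∈ gridCell f.1 := by
      refine fun k l => ⟨fun hkl => hx _ _ ((hs.iff k l ?_ ?_).1
        (Prod.Lex.toLex_lt_toLex.2 (Or.inl ((hg k l).1 hkl)))), fun hkl => ?_⟩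
      · rintro ⟨rfl, rfl⟩; exact hkl.ne hfx
      · rintro ⟨rfl, rfl⟩; exact hkl.ne' hfx
      · rw [hy, hy]; exact (hg k l).2 hkl
    obtain ⟨a, ha⟩ := join hg hg'
    obtain ⟨b, hb⟩ := join hg' hh
    have hab : p.Homotopic (a.trans b) := by
      refine homotopic_of_mem_gridCell p _ hp fun t => ?_
      rw [Path.trans_apply]
      split_ifs
      exacts [(ha _).2, (hb _).2]
    rw [Path.Homotopic.Quotient.eq.2 hab, Path.Homotopic.Quotient.mk_trans, toBaseClass_trans]
    refine (hs.exists_path_isTRep hy hx hgy a fun t => (ha t).1).trans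
      (ih _ ?_ b (fun t => (hb t).2) rfl)
    rw [← hN]
    exact hs.card_lexInv_lt hij

/-! ### Every path is T-representable -/

theorem isTRep_toBaseClass_mk {f g : OrdConf n Plane} (γ : Path f g) :
    IsTRep (toBaseClass (Path.Homotopic.Quotient.mk γ)) := by
  let P : I → I → Prop := fun s t =>
    IsTRep (toBaseClass (Path.Homotopic.Quotient.mk (γ.subpath s t)))
  have hsymm : Std.Symm P := ⟨fun s t h => by
    have := h.symm
    rwa [← toBaseClass_symm, ← Path.Homotopic.Quotient.mk_symm, Path.symm_subpath] at this⟩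
  have htrans : IsTrans I P := ⟨fun r s t h h' => by
    have := h.trans h'
    rwa [← toBaseClass_trans, ← Path.Homotopic.Quotient.mk_trans,
      Path.Homotopic.Quotient.eq.2 ⟨Path.Homotopy.subpathTransSubpath γ r s t⟩] at this⟩
  -- Grid cells are open, so the path remains in the cell of `γ s` for times between `s` and any
  -- nearby `t`, on either side.
  have hloc : ∀ s, ∀ᶠ t in nhds s, P s t := by
    intro s
    have hU : {t | (γ t).1 ∈ gridCell (γ s).1} ∈ nhds s :=
      ((isOpen_gridCell _).preimage (by fun_prop)).mem_nhds (self_mem_gridCell _)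
    have := (Filter.Tendsto.uIcc (tendsto_const_nhds (x := s)) Filter.tendsto_id).eventually
      (Filter.eventually_smallSets.2 ⟨_, hU, fun t h => h⟩)
    filter_upwards [this] with t ht
    refine isTRep_toBaseClass_of_mem_gridCell (γ s) _ fun u => ?_
    have hu := mem_range_self (f := γ.subpath s t) u
    rw [Path.range_subpath] at hu
    obtain ⟨v, hv, hvu⟩ := hu
    rw [← hvu]
    exact ht hv
  have h01 : P 0 1 := PreconnectedSpace.induction₂ P hloc htrans 0 1
  have key : ∀ {f' g'} (hf : f' = f) (hg : g' = g),
      IsTRep (toBaseClass (Path.Homotopic.Quotient.mk (γ.cast hf hg))) →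
      IsTRep (toBaseClass (Path.Homotopic.Quotient.mk γ)) := by
    rintro _ _ rfl rfl h
    exact h
  refine key γ.source γ.target ?_
  rw [← Path.subpath_zero_one]
  exact h01

/-! ### Moving all points to the horizontal segment -/

/-- The lowest point of the vertical segment can be lowered to the horizontal segment, while the
points on the right half of the horizontal segment are pushed outwards. -/
theorem exists_joinedIn_tShape_card_lt {f : OrdConf n Plane} (hf : ∀ k, f.1 k ∈ tShape)
    (hne : (Finset.univ.filter fun k => 0 < (f.1 k).2).Nonempty) :
    ∃ g : OrdConf n Plane, JoinedIn {h : OrdConf n Plane | ∀ k, h.1 k ∈ tShape} f g ∧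
      (Finset.univ.filter fun k => 0 < (g.1 k).2).card <
        (Finset.univ.filter fun k => 0 < (f.1 k).2).card := by
  obtain ⟨i, hi, hmin⟩ := Finset.exists_min_image _ (fun k => (f.1 k).2) hne
  simp only [Finset.mem_filter, Finset.mem_univ, true_and] at hi hmin
  have hf' : ∀ k, ((-1 ≤ (f.1 k).1 ∧ (f.1 k).1 ≤ 1) ∧ (f.1 k).2 = 0) ∨
      ((f.1 k).1 = 0 ∧ 0 < (f.1 k).2 ∧ (f.1 k).2 ≤ 1) := by
    intro k
    rcases mem_tShape.1 (hf k) with h | ⟨h1, h2, h3⟩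
    · exact Or.inl h
    · rcases h2.eq_or_lt with h2 | h2
      · exact Or.inl ⟨by rw [h1]; norm_num, h2.symm⟩
      · exact Or.inr ⟨h1, h2, h3⟩
  have hi0 : (f.1 i).1 = 0 := ((hf' i).resolve_left fun h => hi.ne' h.2).1
  have hi1 : (f.1 i).2 ≤ 1 := ((hf' i).resolve_left fun h => hi.ne' h.2).2.2
  -- Points of the bar at abscissa `x ≥ 0` move halfway towards `1`. This is injective, stays in the
  -- bar, and vacates the origin by the time `i` arrives there.
  let H : ℝ → Fin n → Plane := fun t k =>
    if k = i then (0, (1 - t) * (f.1 i).2) else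
      if (f.1 k).2 = 0 ∧ 0 ≤ (f.1 k).1 then ((f.1 k).1 + t * ((1 - (f.1 k).1) / 2), 0) else f.1 k
  have Hi : ∀ t, H t i = (0, (1 - t) * (f.1 i).2) := fun t => by simp [H]
  have Hr : ∀ t k, k ≠ i → (f.1 k).2 = 0 → 0 ≤ (f.1 k).1 →
      H t k = ((f.1 k).1 + t * ((1 - (f.1 k).1) / 2), 0) := fun t k h1 h2 h3 => by
    simp only [H, h1, h2, h3, and_self, if_true, if_false]
  have Hl : ∀ t k, k ≠ i → (f.1 k).2 = 0 → (f.1 k).1 < 0 → H t k = f.1 k :=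
    fun t k h1 h2 h3 => by simp only [H, h1, h3.not_ge, and_false, if_false]
  have Hu : ∀ t k, k ≠ i → 0 < (f.1 k).2 → H t k = f.1 k :=
    fun t k h1 h2 => by simp only [H, h1, h2.ne', false_and, if_false]
  have cases : ∀ k, k ≠ i → ((f.1 k).2 = 0 ∧ 0 ≤ (f.1 k).1 ∧ (f.1 k).1 ≤ 1) ∨
      ((f.1 k).2 = 0 ∧ -1 ≤ (f.1 k).1 ∧ (f.1 k).1 < 0) ∨
      ((f.1 k).1 = 0 ∧ (f.1 i).2 ≤ (f.1 k).2 ∧ (f.1 k).2 ≤ 1) := by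
    intro k hk
    rcases hf' k with ⟨h1, h2⟩ | ⟨h1, h2, h3⟩
    · rcases le_or_gt 0 (f.1 k).1 with h | h
      · exact Or.inl ⟨h2, h, h1.2⟩
      · exact Or.inr (Or.inl ⟨h2, h1.1, h⟩)
    · exact Or.inr (Or.inr ⟨h1, hmin k h2, h3⟩)
  have Hinj_i : ∀ t ∈ Icc (0 : ℝ) 1, ∀ k, k ≠ i → H t k ≠ H t i := by
    intro t ht k hk e
    rw [Hi] at e
    rcases cases k hk with ⟨h1, h2, h3⟩ | ⟨h1, h2, h3⟩ | ⟨h1, h2, h3⟩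
    · rw [Hr t k hk h1 h2, Prod.mk.injEq] at e
      have : 1 - t = 0 := by
        rcases mul_eq_zero.1 e.2.symm with h | h
        exacts [h, absurd h hi.ne']
      nlinarith [e.1]
    · rw [Hl t k hk h1 h3] at e
      rw [e] at h3
      exact lt_irrefl _ h3
    · rw [Hu t k hk (hi.trans_le h2)] at e
      have e2 : (f.1 k).2 = (1 - t) * (f.1 i).2 := by rw [e]
      refine hk (f.2 (Prod.ext (h1.trans hi0.symm) (le_antisymm ?_ h2)))
      nlinarith [ht.1]
  have Hinj : ∀ t ∈ Icc (0 : ℝ) 1, Function.Injective (H t) := by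
    intro t ht k l e
    by_contra hkl
    by_cases hk : k = i
    · subst hk
      exact Hinj_i t ht l (Ne.symm hkl) e.symm
    by_cases hl : l = i
    · subst hl
      exact Hinj_i t ht k hkl e
    rcases cases k hk with ⟨h1, h2, h3⟩ | ⟨h1, h2, h3⟩ | ⟨h1, h2, h3⟩ <;>
    rcases cases l hl with ⟨h1', h2', h3'⟩ | ⟨h1', h2', h3'⟩ | ⟨h1', h2', h3'⟩
    · rw [Hr t k hk h1 h2, Hr t l hl h1' h2', Prod.mk.injEq] at e
      refine hkl (f.2 (Prod.ext ?_ (h1.trans h1'.symm)))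
      have h : ((f.1 k).1 - (f.1 l).1) * (1 - t / 2) = 0 := by linear_combination e.1
      rcases mul_eq_zero.1 h with h | h
      · exact sub_eq_zero.1 h
      · linarith [ht.2]
    · rw [Hr t k hk h1 h2, Hl t l hl h1' h3'] at e
      rw [← e] at h3'
      nlinarith [ht.1]
    · rw [Hr t k hk h1 h2, Hu t l hl (hi.trans_le h2')] at e
      rw [← e] at h2'
      exact hi.not_ge h2'
    · rw [Hl t k hk h1 h3, Hr t l hl h1' h2'] at e
      rw [e] at h3
      nlinarith [ht.1]
    · rw [Hl t k hk h1 h3, Hl t l hl h1' h3'] at e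
      exact hkl (f.2 e)
    · rw [Hl t k hk h1 h3, Hu t l hl (hi.trans_le h2')] at e
      exact hkl (f.2 e)
    · rw [Hu t k hk (hi.trans_le h2), Hr t l hl h1' h2'] at e
      rw [e] at h2
      exact hi.not_ge h2
    · rw [Hu t k hk (hi.trans_le h2), Hl t l hl h1' h3'] at e
      exact hkl (f.2 e)
    · rw [Hu t k hk (hi.trans_le h2), Hu t l hl (hi.trans_le h2')] at e
      exact hkl (f.2 e)
  have HT : ∀ t ∈ Icc (0 : ℝ) 1, ∀ k, H t k ∈ tShape := by
    intro t ht k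
    by_cases hk : k = i
    · subst hk
      rw [Hi, mem_tShape]
      right
      exact ⟨rfl, mul_nonneg (by linarith [ht.2]) hi.le, by dsimp only; nlinarith [ht.1]⟩
    rcases cases k hk with ⟨h1, h2, h3⟩ | ⟨h1, h2, h3⟩ | ⟨h1, h2, h3⟩
    · rw [Hr t k hk h1 h2, mem_tShape]
      left
      exact ⟨⟨by dsimp only; nlinarith [ht.1], by dsimp only; nlinarith [ht.2]⟩, rfl⟩
    · rw [Hl t k hk h1 h3]
      exact hf k
    · rw [Hu t k hk (hi.trans_le h2)]
      exact hf k
  refine ⟨⟨H 1, Hinj 1 (by norm_num)⟩, ⟨⟨⟨fun t => ⟨H t, Hinj t t.2⟩, ?_⟩, Subtype.ext ?_, ?_⟩,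
    fun t k => HT t t.2 k⟩, ?_⟩
  · refine Continuous.subtype_mk (continuous_pi fun k => ?_) _
    simp only [H]
    split_ifs <;> fun_prop
  · funext k
    by_cases hk : k = i
    · subst hk
      exact (Hi _).trans (Prod.ext hi0.symm (by simp))
    rcases cases k hk with ⟨h1, h2, h3⟩ | ⟨h1, h2, h3⟩ | ⟨h1, h2, h3⟩
    · exact (Hr _ k hk h1 h2).trans (Prod.ext (by simp) h1.symm)
    · exact Hl _ k hk h1 h3
    · exact Hu _ k hk (hi.trans_le h2)
  · simp
  · refine Finset.card_lt_card (Finset.ssubset_iff_of_subset ?_ |>.2 ⟨i, by simpa using hi, ?_⟩)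
    · intro k hk
      simp only [Finset.mem_filter, Finset.mem_univ, true_and] at hk ⊢
      by_cases hki : k = i
      · rwa [hki]
      rcases cases k hki with ⟨h1, h2, h3⟩ | ⟨h1, h2, h3⟩ | ⟨h1, h2, h3⟩
      · rw [Hr _ k hki h1 h2] at hk
        exact absurd hk (lt_irrefl _)
      · rwa [Hl _ k hki h1 h3] at hk
      · exact hi.trans_le h2
    · simp [Hi]

theorem exists_joinedIn_tShape_lineTuples (f : OrdConf n Plane) (hf : ∀ k, f.1 k ∈ tShape) :
    ∃ g : OrdConf n Plane, g.1 ∈ lineTuples n ∧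
      JoinedIn {h : OrdConf n Plane | ∀ k, h.1 k ∈ tShape} f g := by
  induction hN : (Finset.univ.filter fun k => 0 < (f.1 k).2).card using Nat.strong_induction_on
    generalizing f with
  | _ N ih =>
  rcases (Finset.univ.filter fun k => 0 < (f.1 k).2).eq_empty_or_nonempty with he | hne
  · refine ⟨f, fun k => (hf k).elim id fun h => ?_, JoinedIn.refl hf⟩
    have hk : (f.1 k).2 = 0 := le_antisymm (not_lt.1 fun h' => by
      have : k ∈ Finset.univ.filter fun k => 0 < (f.1 k).2 := by simpa using h'
      simp [he] at this) h.2.1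
    have h1 : (f.1 k).1 = 0 := h.1
    exact ⟨by rw [h1]; norm_num, hk⟩
  · obtain ⟨g, hfg, hlt⟩ := exists_joinedIn_tShape_card_lt hf hne
    obtain ⟨l, hl, hgl⟩ := ih _ (hN ▸ hlt) g hfg.target_mem rfl
    exact ⟨l, hl, hfg.trans hgl⟩

theorem isTRep_toLexBase {f : OrdConf n Plane} (hf : f.1 ∈ lineTuples n) :
    IsTRep (Path.Homotopic.Quotient.mk (toLexBase f)) := by
  obtain ⟨p, hp⟩ := joinedIn_lineTuples (self_mem_lexCell f.1) (lexBase_mem_lexCell f) hf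
    (lexBase_mem_lineTuples f)
  refine ⟨p, fun t => mem_tShape_of_mem_lineTuples (hp t).2, Path.Homotopic.Quotient.eq.2 ?_⟩
  exact OrdConf.homotopic_of_starConvex ((convex_lexCell f.1).starConvex (self_mem_lexCell _))
      (fun _ => injective_of_mem_lexCell f.2) _ _ (fun t => (hp t).1) (toLexBase_mem f)

/-- Every path of planar configurations between configurations in the T-shaped set is homotopic,
relative to its endpoints, to a path of configurations in the T-shaped set. -/
theorem exists_homotopic_tShape {f g : OrdConf n Plane} (hf : ∀ k, f.1 k ∈ tShape)
    (hg : ∀ k, g.1 k ∈ tShape) (γ : Path f g) :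
    ∃ γ' : Path f g, (∀ t k, (γ' t).1 k ∈ tShape) ∧ γ.Homotopic γ' := by
  suffices h : IsTRep (Path.Homotopic.Quotient.mk γ) by
    obtain ⟨γ', h, h'⟩ := h
    exact ⟨γ', h, (Path.Homotopic.Quotient.eq.1 h').symm⟩
  obtain ⟨f', hf', p, hp⟩ := exists_joinedIn_tShape_lineTuples f hf
  obtain ⟨g', hg', q, hq⟩ := exists_joinedIn_tShape_lineTuples g hg
  -- For `f'` and `g'` on the bar the transport to base configurations can be undone inside the T.
  -- Conjugating by `p` and `q` then recovers the class of `γ` after cancellation.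
  have h := ((isTRep_toLexBase hf').trans
    (isTRep_toBaseClass_mk ((p.symm.trans γ).trans q))).trans (isTRep_toLexBase hg').symm
  have hp' : IsTRep (Path.Homotopic.Quotient.mk p) := ⟨p, hp, rfl⟩
  have hq' : IsTRep (Path.Homotopic.Quotient.mk q) := ⟨q, hq, rfl⟩
  have h' := (hp'.trans h).trans hq'.symm
  have cancel : ∀ {x y z : OrdConf n Plane} (a : Path.Homotopic.Quotient x y)
      (b : Path.Homotopic.Quotient x z), a.trans (a.symm.trans b) = b := fun a b => by
    rw [← Path.Homotopic.Quotient.trans_assoc, Path.Homotopic.Quotient.trans_symm,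
      Path.Homotopic.Quotient.refl_trans]
  simpa [toBaseClass, Path.Homotopic.Quotient.mk_trans, Path.Homotopic.Quotient.mk_symm,
    Path.Homotopic.Quotient.trans_assoc, cancel] using h'

/-! ### The covering of the unordered by the ordered configuration space -/

instance OrdConf.instContinuousConstSMul (n : ℕ) (X : Type*) [TopologicalSpace X] :
    ContinuousConstSMul (Equiv.Perm (Fin n)) (OrdConf n X) where
  continuous_const_smul e := continuous_induced_rng.2 (continuous_pi fun i =>
    (continuous_apply (e⁻¹ i)).comp continuous_subtype_val)

instance OrdConf.instIsCancelSMul (n : ℕ) (X : Type*) :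
    IsCancelSMul (Equiv.Perm (Fin n)) (OrdConf n X) where
  right_cancel' e e' f h := by
    refine inv_injective (Equiv.ext fun i => f.2 ?_)
    exact congrFun (congrArg Subtype.val h) i

/-- A finite group acts freely on a locally compact Hausdorff space; local compactness holds because
injectivity is an open condition on tuples. -/
theorem OrdConf.isCoveringMap_mk (n : ℕ) :
    IsCoveringMap (Quotient.mk'' : OrdConf n Plane → Conf n Plane) := by
  have hopen : IsOpen {f : Fin n → Plane | Function.Injective f} := by
    have : {f : Fin n → Plane | Function.Injective f} =
        ⋂ i, ⋂ j, {f | i ≠ j → f i ≠ f j} := by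
      ext f
      simp only [mem_ofPred_eq, mem_iInter, Function.Injective]
      exact forall₂_congr fun i j => not_imp_not.symm
    rw [this]
    refine isOpen_iInter_of_finite fun i => isOpen_iInter_of_finite fun j => ?_
    by_cases h : i = j
    · simp [h]
    · simpa [h] using isOpen_ne_fun (continuous_apply i) (continuous_apply j)
  have : LocallyCompactSpace (OrdConf n Plane) := hopen.locallyCompactSpace
  exact (isQuotientCoveringMap_quotientMk_of_properlyDiscontinuousSMul
    (E := OrdConf n Plane) (G := Equiv.Perm (Fin n))).isCoveringMap

theorem Conf.continuous_mk (n : ℕ) (X : Type*) [TopologicalSpace X] :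
    Continuous (Quotient.mk'' : OrdConf n X → Conf n X) := continuous_quotient_mk'

theorem Conf.mk_smul {X : Type*} (e : Equiv.Perm (Fin n)) (f : OrdConf n X) :
    (Quotient.mk'' (e • f) : Conf n X) = Quotient.mk'' f :=
  Quotient.eq''.2 ⟨e, rfl⟩

theorem exists_lift (γ : C(I, Conf n Plane)) (f : OrdConf n Plane) (hf : γ 0 = Quotient.mk'' f) :
    ∃ (g : OrdConf n Plane) (Γ : Path f g), ∀ t, Quotient.mk'' (Γ t) = γ t :=
  ⟨_, ⟨(OrdConf.isCoveringMap_mk n).liftPath γ f hf,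
    (OrdConf.isCoveringMap_mk n).liftPath_zero γ f hf, rfl⟩,
    fun t => congrFun ((OrdConf.isCoveringMap_mk n).liftPath_lifts γ f hf) t⟩

/-! ### Free homotopies -/

/-- Concatenating a path with a path at its start and a path at its end is a continuous
deformation, whose endpoints move along the two added paths. -/
theorem exists_freeHomotopy {Y : Type*} [TopologicalSpace Y] {x y x' y' : Y} (γ : Path x y)
    (p : Path x x') (q : Path y y') :
    ∃ H : C(I × I, Y), (∀ t, H (0, t) = γ t) ∧ (∀ u, H (u, 0) = p u) ∧ ∀ u, H (u, 1) = q u := by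
  -- `D` runs through reversed `p`, then `γ`, then `q`. Stage `u` of the deformation traverses the
  -- window from `-u` to `1 + u`.
  let D : ℝ → Y := fun s => if s ≤ 0 then p.extend (-s) else
    if s ≤ 1 then γ.extend s else q.extend (s - 1)
  have hD : Continuous D := by
    refine Continuous.if_le (by fun_prop) (Continuous.if_le (by fun_prop) (by fun_prop)
      continuous_id continuous_const ?_) continuous_id continuous_const ?_
    · rintro s rfl; simp
    · rintro s rfl; simp
  refine ⟨⟨fun z => D (-z.1 + z.2 * (1 + 2 * z.1)), by fun_prop⟩, fun t => ?_, fun u => ?_,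
    fun u => ?_⟩
  · have h1 : (t : ℝ) ≤ 1 := t.2.2
    by_cases h : (t : ℝ) ≤ 0
    · obtain rfl : t = 0 := Subtype.ext (le_antisymm h t.2.1)
      simp [D]
    · simp [D, h, h1]
  · have : (u : ℝ) ∈ Icc (0 : ℝ) 1 := u.2
    simp [D, u.2.1]
  · have e : -(u : ℝ) + ((1 : I) : ℝ) * (1 + 2 * u) = 1 + u := by
      rw [Icc.coe_one]; ring
    have h0 : ¬(1 + (u : ℝ) ≤ 0) := by linarith [u.2.1]
    simp only [ContinuousMap.coe_mk, e, D, h0, if_false]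
    by_cases h : 1 + (u : ℝ) ≤ 1
    · obtain rfl : u = 0 := Subtype.ext (le_antisymm (add_le_iff_nonpos_right (1 : ℝ) |>.1 h) u.2.1)
      simp
    · simp [h]

theorem exists_freelyHomotopic_tShape (γ : C(I, Conf n Plane)) (hγ : γ 0 = γ 1) :
    ∃ γ' : C(I, Conf n Plane), γ' 0 = γ' 1 ∧ (∀ t, (γ' t).points ⊆ tShape) ∧
      ContinuousMap.HomotopicWith γ γ' (fun δ => δ 0 = δ 1) := by
  obtain ⟨f, hf⟩ := Quotient.mk''_surjective (γ 0)
  obtain ⟨g, Γ, hΓ⟩ := exists_lift γ f hf.symm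
  obtain ⟨e, rfl⟩ : ∃ e : Equiv.Perm (Fin n), e • f = g := by
    have : (Quotient.mk'' g : Conf n Plane) = Quotient.mk'' f := by
      rw [hf, hγ, ← hΓ 1, Γ.target]
    exact Quotient.eq''.1 this
  let p := toLexBase f
  let π : C(OrdConf n Plane, Conf n Plane) := ⟨_, Conf.continuous_mk n Plane⟩
  -- The end of the lift is dragged along the `e`-translate of the path that drags its start. Both
  -- project to the same path, so every stage projects to a loop.
  obtain ⟨H, H0, Hl, Hr⟩ := exists_freeHomotopy Γ p (p.map (continuous_const_smul e))
  let Γ₁ : Path (lexBase f) (e • lexBase f) :=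
    ⟨⟨fun t => H (1, t), by fun_prop⟩, by simp [Hl], by simp [Hr]⟩
  have hb : ∀ k, (lexBase f).1 k ∈ tShape :=
    mem_tShape_of_mem_lineTuples (lexBase_mem_lineTuples f)
  obtain ⟨Γ₂, hΓ₂, ⟨F⟩⟩ := exists_homotopic_tShape hb (fun k => hb (e⁻¹ k)) Γ₁
  refine ⟨π.comp Γ₂, ?_, ?_, ContinuousMap.HomotopicWith.trans (g := π.comp Γ₁)
    ⟨⟨⟨π.comp H, ?_, fun _ => rfl⟩, ?_⟩⟩ ⟨⟨⟨π.comp F.toContinuousMap, ?_, ?_⟩, ?_⟩⟩⟩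
  · exact (congrArg π Γ₂.source).trans ((Conf.mk_smul e _).symm.trans (congrArg π Γ₂.target).symm)
  · intro t
    exact range_subset_iff.2 (hΓ₂ t)
  · intro t
    exact (congrArg π (H0 t)).trans (hΓ t)
  · intro u
    exact (congrArg π (Hl u)).trans ((Conf.mk_smul e _).symm.trans (congrArg π (Hr u)).symm)
  · intro t
    exact congrArg π (F.map_zero_left t)
  · intro t
    exact congrArg π (F.map_one_left t)
  · intro u
    exact (congrArg π (F.source u)).trans
      ((Conf.mk_smul e _).symm.trans (congrArg π (F.target u)).symm)

/-- The lift of a loop based in the T starts and ends at labellings of the same configuration. Hence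
it deforms into the T relative to its endpoints, and the homotopy projects to one fixing the base
point. -/
theorem surjective_fundamentalGroup_map_incl (c : Conf n tShape) :
    Function.Surjective (FundamentalGroup.map (Conf.incl n tShape) c) := by
  intro x
  obtain ⟨γ, rfl⟩ := Path.Homotopic.Quotient.mk_surjective
    (x₀ := Conf.incl n tShape c) (x₁ := Conf.incl n tShape c) x
  obtain ⟨f, rfl⟩ := Quotient.mk''_surjective c
  let f' : OrdConf n Plane := ⟨fun i => (f.1 i : Plane), Subtype.val_injective.comp f.2⟩
  obtain ⟨g, Γ, hΓ⟩ := exists_lift γ.toContinuousMap f' γ.source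
  obtain ⟨e, rfl⟩ : ∃ e : Equiv.Perm (Fin n), e • f' = g := by
    have : (Quotient.mk'' g : Conf n Plane) = Quotient.mk'' f' := by
      rw [← Γ.target, hΓ 1]
      exact γ.target
    exact Quotient.eq''.1 this
  obtain ⟨Γ₂, hΓ₂, ⟨F⟩⟩ := exists_homotopic_tShape (fun k => (f.1 k).2)
    (fun k => (f.1 (e⁻¹ k)).2) Γ
  have hinj : ∀ t, Function.Injective fun k => (⟨(Γ₂ t).1 k, hΓ₂ t k⟩ : tShape) := fun t k l h =>
    (Γ₂ t).2 (congrArg Subtype.val h)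
  have hcont : Continuous fun t : I =>
      (⟨fun k => ⟨(Γ₂ t).1 k, hΓ₂ t k⟩, hinj t⟩ : OrdConf n tShape) :=
    Continuous.subtype_mk (continuous_pi fun k => Continuous.subtype_mk
      ((continuous_apply k).comp (continuous_subtype_val.comp Γ₂.continuous)) _) _
  let δ : Path (Quotient.mk'' f : Conf n tShape) (Quotient.mk'' f) :=
    ⟨⟨fun t => Quotient.mk'' ⟨_, hinj t⟩, (Conf.continuous_mk n tShape).comp hcont⟩, by
      refine congrArg Quotient.mk'' (Subtype.ext (funext fun k => Subtype.ext ?_))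
      exact congrFun (congrArg Subtype.val Γ₂.source) k, by
      refine Eq.trans (congrArg Quotient.mk'' (Subtype.ext (funext fun k => Subtype.ext ?_)))
        (Conf.mk_smul e f)
      exact congrFun (congrArg Subtype.val Γ₂.target) k⟩
  refine ⟨Path.Homotopic.Quotient.mk δ, ?_⟩
  refine (Path.Homotopic.Quotient.eq (p := δ.map (Conf.incl n tShape).continuous) (q := γ)).2 ?_
  let π : C(OrdConf n Plane, Conf n Plane) := ⟨_, Conf.continuous_mk n Plane⟩
  refine Path.Homotopic.symm ⟨⟨⟨π.comp F.toContinuousMap, ?_, ?_⟩, ?_⟩⟩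
  · intro t
    exact (congrArg π (F.map_zero_left t)).trans (hΓ t)
  · intro t
    exact congrArg π (F.map_one_left t)
  · intro u t ht
    have h : F (u, t) = Γ t := F.prop' u t ht
    exact (congrArg π h).trans (hΓ t)

/-- The strands form a path of ordered configurations, and a homotopy of this path relative to its
endpoints is an isotopy of braids. The final points lie in the T because they are the initial points
permuted. -/
theorem GeomBraid.exists_isotopic_carrier_subset (β : GeomBraid n)
    (hβ : ∀ i, β.strand i 0 ∈ tShape) :
    ∃ β' : GeomBraid n, β.Isotopic β' ∧ β'.carrier ⊆ threePageBook := by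
  let f : OrdConf n Plane := ⟨_, β.disjoint 0⟩
  let g : OrdConf n Plane := ⟨_, β.disjoint 1⟩
  let Γ : Path f g := ⟨⟨fun t => ⟨_, β.disjoint t⟩, by fun_prop⟩, rfl, rfl⟩
  have hg : ∀ i, g.1 i ∈ tShape := by
    intro i
    obtain ⟨j, hj⟩ : β.strand i 1 ∈ range fun i => β.strand i 0 := β.closed ▸ mem_range_self i
    exact (congrArg (· ∈ tShape) hj).mp (hβ j)
  obtain ⟨Γ', hΓ', ⟨F⟩⟩ := exists_homotopic_tShape (f := f) hβ hg Γ
  have hF0 : ∀ u i, (F (u, 0)).1 i = β.strand i 0 := fun u i => by rw [F.source]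
  have hF1 : ∀ u i, (F (u, 1)).1 i = β.strand i 1 := fun u i => by rw [F.target]
  have hF : ∀ i, Continuous fun z => (F z).1 i := fun i =>
    (continuous_apply i).comp (continuous_subtype_val.comp F.continuous)
  let H : I → GeomBraid n := fun u =>
    { strand := fun i => ⟨fun t => (F (u, t)).1 i, (hF i).comp (by fun_prop)⟩
      disjoint := fun t => (F (u, t)).2
      closed := by
        simp only [ContinuousMap.coe_mk, hF0, hF1]
        exact β.closed }
  refine ⟨H 1, ⟨H, fun i => hF i, ?_, rfl, fun u i => ⟨hF0 u i, hF1 u i⟩⟩, ?_⟩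
  · ext i t : 3
    exact congrFun (congrArg Subtype.val (F.map_zero_left t)) i
  · rintro ⟨x, t⟩ ⟨i, hi⟩
    refine ⟨?_, mem_univ _⟩
    have h : (F (1, t)).1 i = (Γ' t).1 i := congrFun (congrArg Subtype.val (F.map_one_left t)) i
    have hi' : (F (1, t)).1 i = x := hi
    change x ∈ tShape
    rw [← hi', h]
    exact hΓ' t i

theorem mainTheorem1 (n : ℕ) :
    -- every loop in `C_n` is freely homotopic to a loop of configurations lying in the T
    (∀ γ : C(I, Conf n Plane), γ 0 = γ 1 →
      ∃ γ' : C(I, Conf n Plane), γ' 0 = γ' 1 ∧ (∀ t, (γ' t).points ⊆ tShape) ∧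
        ContinuousMap.HomotopicWith γ γ' (fun δ => δ 0 = δ 1)) ∧
    -- the inclusion of configuration spaces is surjective on fundamental groups
    (∀ c : Conf n tShape,
      Function.Surjective (FundamentalGroup.map (Conf.incl n tShape) c)) ∧
    -- every braid with endpoints in the T is isotopic to one inside the three-page book
    (∀ β : GeomBraid n, (∀ i, β.strand i 0 ∈ tShape) →
      ∃ β' : GeomBraid n, β.Isotopic β' ∧ β'.carrier ⊆ threePageBook) :=
  ⟨exists_freelyHomotopic_tShape, surjective_fundamentalGroup_map_incl,
    GeomBraid.exists_isotopic_carrier_subset⟩
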